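/- Let $\alpha > -1/2$, and let $f\colon [0,\infty)\to\mathbb{R}$ be continuous and satisfy $|f(x)| \le C(1+|x|)^{-\alpha-1-\varepsilon}$ for all $x \ge 0$, for some constants $C>0$ and $\varepsilon>0$. For $j \ge 0$ let $L_j^\alpha$ be the Laguerre polynomial of degree $j$ and parameter $\alpha$, $$ L_j^\alpha(x)=\sum_{i=0}^{j}(-1)^i\binom{j+\alpha}{j-i}\frac{x^i}{i!}, $$ and let $J_\alpha(x)=\sum_{m\ge 0}\frac{(-1)^m}{m!\,\Gamma(m+\alpha+1)}\left(\frac{x}{2}\right)^{2m+\alpha}$ be the Bessel function of the first kind. A function $f\colon [0,\infty)\to\mathbb{R}$ has the $\alpha$-SILP property ("scale-invariant Laguerre positivity") if it is continuous, satisfies a bound $|f(x)| \le C(1+|x|)^{-\alpha-1-\varepsilon}$ for some $C,\varepsilon>0$, and for every $y>0$ and every $j\ge 0$ the Laguerre coefficient $$ a_j(y)=\frac{\int_0^\infty f(x/y)\,L_j^\alpha(x)\,x^\alpha e^{-x}\,dx}{\int_0^\infty L_j^\alpha(x)^2\,x^\alpha e^{-x}\,dx} $$ of the function $x\mapsto f(x/y)$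 is non-negative. Then $f$ has the $\alpha$-SILP property if and only if there is a weakly increasing function $g\colon[0,\infty)\to\mathbb{R}$ such that, for every $x\ge 0$, the following Stieltjes integral converges (absolutely) and $$ f(x)=\int_0^\infty (xy)^{-\alpha/2}J_\alpha\bigl(2\sqrt{xy}\bigr)\,dg(y), $$ where $t^{-\alpha/2}J_\alpha(2\sqrt t)$ is given its limiting value $1/\Gamma(\alpha+1)$ at $t=0$, and a jump $g(0+)-g(0)$ of $g$ at $0$ counts as a point mass of $dg$ at $0$. -/

import Mathlib

noncomputable section

namespace SILP

/-- The generalized Laguerre polynomial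
`L_k^α(x) = ∑_{i ≤ k} (-1)^i * binom(k + α, k - i) * x^i / i!` for `α > -1`, the binomial coefficient
being written as `Γ(k + α + 1) / ((k - i)! Γ(i + α + 1))`. -/
def laguerre (α : ℝ) (k : ℕ) (x : ℝ) : ℝ :=
  ∑ i ∈ Finset.range (k + 1),
    (-1) ^ i * (Real.Gamma (k + α + 1) / ((k - i).factorial * Real.Gamma (i + α + 1))) *
      (x ^ i / i.factorial)

/-- The Bessel function of the first kind,
`J_α(x) = ∑_{m ≥ 0} (-1)^m / (m! Γ(m + α + 1)) * (x / 2)^(2 m + α)`, for `α > -1` and `x ≥ 0`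
(`x > 0` if `α < 0`). -/
def besselJ (α x : ℝ) : ℝ :=
  ∑' m : ℕ, (-1) ^ m / (m.factorial * Real.Gamma (m + α + 1)) * (x / 2) ^ (2 * m + α)

/-- The function `t ↦ t^(-α/2) J_α(2 √t)` on `[0, ∞)`, with its limit `1 / Γ(α + 1)` as the value
at `t = 0`, where the expression itself is not defined. -/
def besselKernel (α t : ℝ) : ℝ :=
  if t = 0 then 1 / Real.Gamma (α + 1) else t ^ (-α / 2) * besselJ α (2 * √t)

/-- The `j`-th coefficient of the Laguerre series `∑ a_j L_j^α` of a function `h` on `[0, ∞)`. -/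
def laguerreCoeff (α : ℝ) (h : ℝ → ℝ) (j : ℕ) : ℝ :=
  (∫ x in Set.Ioi (0 : ℝ), h x * laguerre α j x * x ^ α * Real.exp (-x)) /
    ∫ x in Set.Ioi (0 : ℝ), laguerre α j x ^ 2 * x ^ α * Real.exp (-x)

/-- Continuity on `[0, ∞)` and the bound `|f(x)| ≤ C (1 + |x|)^(-α-1-ε)` there, for some
`C, ε > 0`. -/
def ContinuousDecay (α : ℝ) (f : ℝ → ℝ) : Prop :=
  ContinuousOn f (Set.Ici 0) ∧
    ∃ ε : ℝ, 0 < ε ∧ ∃ C : ℝ, 0 < C ∧ ∀ x, 0 ≤ x → |f x| ≤ C * (1 + |x|) ^ (-α - 1 - ε)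

/-- The `α`-SILP property of a function on `[0, ∞)`, given as the restriction of `f : ℝ → ℝ`. -/
def HasSILP (α : ℝ) (f : ℝ → ℝ) : Prop :=
  ContinuousDecay α f ∧
    ∀ y, 0 < y → ∀ j : ℕ, 0 ≤ laguerreCoeff α (fun x => f (x / y)) j

theorem monotone_comp_max {g : ℝ → ℝ} (hg : MonotoneOn g (Set.Ici 0)) :
    Monotone fun y => g (max y 0) :=
  fun _ _ hab => hg (Set.mem_Ici.2 (le_max_right _ _)) (Set.mem_Ici.2 (le_max_right _ _)) (
    max_le_max_right 0 hab)

/-- The Lebesgue–Stieltjes measure `dg` of a weakly increasing function `g` on `[0, ∞)`: `g` is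
extended by the constant `g 0` to the left of `0`, so that `dg` lives on `[0, ∞)`, gives `{0}` the mass
`g(0+) - g(0)`, and gives `(a, b]` the mass `g(b+) - g(a+)`. -/
def stieltjesMeasure {g : ℝ → ℝ} (hg : MonotoneOn g (Set.Ici 0)) : MeasureTheory.Measure ℝ :=
  (monotone_comp_max hg).stieltjesFunction.measure

end SILP

end

noncomputable section

namespace SILP

open Real Set MeasureTheory Filter Topology

/-! Write Λ for `besselSeries α` and Hφ(s) = ∫ Λ(xs) φ(x) x^α dx for the Hankel transform on (0, ∞).
Since α > -1/2, Λ is bounded on [0, ∞), so Fubini makes H symmetric for x^α dx. H exchanges the two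
families of the problem: t^j e^(-t) goes to j! L_j e^(-x) (`hankel_pow_mul_exp`), and L_j e^(-t)
goes to s^j e^(-s) / j! (`hankel_laguerre_mul_exp`).

By symmetry, the Laguerre coefficients of f(x/y) are, up to positive factors, the averages of Hf
against Gamma densities of scale y (`integral_laguerre_eq_gamma_average`). Gamma densities of large
shape concentrate, so SILP forces Hf ≥ 0 (`nonneg_of_gamma_averages_nonneg`). The averages with j =
0 are bounded uniformly in y, hence Hf is integrable against s^α (`integrableOn_hankel`). Then HHf
and f have the same Gamma averages and so coincide (`hankel_hankel`), and dg = Hf(s) s^α ds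
represents f.

Conversely, if f is the transform of a positive measure, Fubini turns each coefficient into the
integral of a positive function s^j e^(-s/y), up to a positive factor
(`integral_laguerre_nonneg_of_measure`). -/

/-! ### The Bessel kernel as an entire function, and its boundedness. -/

/-- The entire function `t ↦ t^(-α/2) J_α(2 √t)`, as a power series. -/
def besselSeries (α t : ℝ) : ℝ :=
  ∑' m : ℕ, (-1) ^ m * t ^ m / (m.factorial * Gamma (m + α + 1))

theorem Gamma_nat_add_pos {α : ℝ} (hα : -1 < α) (m : ℕ) : 0 < Gamma (m + α + 1) :=
  Gamma_pos_of_pos (by have := m.cast_nonneg (α := ℝ); linarith)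

theorem Gamma_nat_succ_add {α : ℝ} (hα : -1 < α) (m : ℕ) :
    Gamma (((m + 1 : ℕ) : ℝ) + α + 1) = (m + α + 1) * Gamma (m + α + 1) := by
  have h : (m : ℝ) + α + 1 ≠ 0 := by have := m.cast_nonneg (α := ℝ); linarith
  rw [← Gamma_add_one h]; push_cast; ring_nf

theorem exists_pos_le_Gamma_nat_add {α : ℝ} (hα : -1 < α) :
    ∃ c : ℝ, 0 < c ∧ ∀ m : ℕ, c ≤ Gamma (m + α + 1) := by
  have h1 : ∀ m : ℕ, Gamma (((1 : ℕ) : ℝ) + α + 1) ≤ Gamma (((m + 1 : ℕ) : ℝ) + α + 1) := by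
    intro m
    induction m with
    | zero => simp
    | succ m ih =>
      rw [Gamma_nat_succ_add hα (m + 1)]
      have h2 := Gamma_nat_add_pos hα (m + 1)
      have h3 : (0 : ℝ) ≤ m := m.cast_nonneg
      have h4 : (1 : ℝ) ≤ ((m + 1 : ℕ) : ℝ) + α + 1 := by push_cast; linarith
      nlinarith
  -- The step from m = 0 to m = 1 multiplies by α + 1, which may be less than 1; all later factors
  -- are at least 1.
  refine ⟨min (Gamma (((0 : ℕ) : ℝ) + α + 1)) (Gamma (((1 : ℕ) : ℝ) + α + 1)),
    lt_min (Gamma_nat_add_pos hα 0) (Gamma_nat_add_pos hα 1), fun m => ?_⟩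
  cases m with
  | zero => exact min_le_left _ _
  | succ m => exact (min_le_right _ _).trans (h1 m)

theorem summable_besselSeries {α : ℝ} (hα : -1 < α) (t : ℝ) :
    Summable fun m : ℕ => (-1) ^ m * t ^ m / (m.factorial * Gamma (m + α + 1)) := by
  obtain ⟨c, hc, h⟩ := exists_pos_le_Gamma_nat_add hα
  refine Summable.of_norm_bounded ((Real.summable_pow_div_factorial |t|).mul_left c⁻¹) fun m => ?_
  have hG := Gamma_nat_add_pos hα m
  rw [norm_div, norm_mul, norm_mul, norm_pow, norm_pow, norm_neg, norm_one, one_pow, one_mul,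
    Real.norm_of_nonneg hG.le, Real.norm_natCast, Real.norm_eq_abs, ← div_eq_inv_mul, div_div]
  gcongr
  exact h m

theorem besselSeries_zero (α : ℝ) : besselSeries α 0 = 1 / Gamma (α + 1) := by
  rw [besselSeries, tsum_eq_single 0]
  · simp
  · intro m hm; simp [hm]

theorem hasDerivAt_besselSeries {α : ℝ} (hα : -1 < α) (t : ℝ) :
    HasDerivAt (besselSeries α) (-besselSeries (α + 1) t) t := by
  obtain ⟨c, hc, h⟩ := exists_pos_le_Gamma_nat_add hα
  set R : ℝ := |t| + 1
  have hR : 0 ≤ R := by positivity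
  have hu : Summable fun m : ℕ => (m : ℝ) * R ^ (m - 1) / (m.factorial * c) := by
    rw [← summable_nat_add_iff 1]
    refine ((Real.summable_pow_div_factorial R).mul_left c⁻¹).congr fun m => ?_
    have : ((m + 1 : ℕ) : ℝ) ≠ 0 := by positivity
    rw [Nat.factorial_succ]; push_cast at this ⊢; field_simp
  have key := hasDerivAt_tsum_of_isPreconnected (t := Metric.ball 0 R) (y₀ := 0) (y := t)
    (g := fun (m : ℕ) t => (-1 : ℝ) ^ m * t ^ m / (m.factorial * Gamma (m + α + 1)))
    (g' := fun (m : ℕ) t => (-1 : ℝ) ^ m * (m * t ^ (m - 1)) / (m.factorial * Gamma (m + α + 1)))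
    hu Metric.isOpen_ball (convex_ball 0 R).isPreconnected
    (fun m y _ => ((hasDerivAt_pow m y).const_mul _).div_const _)
    (fun m y hy => ?_) (by simp [R]; positivity) (summable_besselSeries hα 0) (by simp [R])
  · have hterm : ∀ m : ℕ, -((-1 : ℝ) ^ m * t ^ m / (m.factorial * Gamma (m + (α + 1) + 1))) =
        (-1 : ℝ) ^ (m + 1) * ((m + 1 : ℕ) * t ^ (m + 1 - 1)) /
          ((m + 1).factorial * Gamma ((m + 1 : ℕ) + α + 1)) := by
      intro m
      have : ((m + 1 : ℕ) : ℝ) ≠ 0 := by positivity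
      rw [Nat.factorial_succ]; push_cast at this ⊢
      rw [show (m : ℝ) + 1 + α + 1 = m + (α + 1) + 1 by ring]
      field_simp; ring
    have hs : Summable fun m : ℕ =>
        (-1 : ℝ) ^ m * (m * t ^ (m - 1)) / (m.factorial * Gamma (m + α + 1)) := by
      rw [← summable_nat_add_iff 1]
      exact (summable_besselSeries (α := α + 1) (by linarith) t).neg.congr hterm
    convert! key using 1
    rw [hs.tsum_eq_zero_add]
    simp only [besselSeries, CharP.cast_eq_zero, zero_mul, mul_zero, zero_div, zero_add, ← tsum_neg]
    exact tsum_congr hterm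
  · have hG := Gamma_nat_add_pos hα m
    have hy' : |y| ≤ R := by simpa using (Metric.mem_ball.1 hy).le
    rw [norm_div, norm_mul, norm_mul, norm_mul, norm_pow, norm_pow, norm_neg, norm_one, one_pow,
      one_mul, Real.norm_of_nonneg hG.le, Real.norm_natCast, Real.norm_natCast, Real.norm_eq_abs]
    gcongr
    exact h m

theorem continuous_besselSeries {α : ℝ} (hα : -1 < α) : Continuous (besselSeries α) :=
  continuous_iff_continuousAt.2 fun t => (hasDerivAt_besselSeries hα t).continuousAt

/-- As differentiation sends Λ_α to -Λ_(α+1), this is Bessel's equation t Λ'' + (α + 1) Λ' + Λ = 0.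
In Λ_α - (α + 1) Λ_(α+1) the constant terms cancel and the remaining series is -t Λ_(α+2). -/
theorem besselSeries_recurrence {α : ℝ} (hα : -1 < α) (t : ℝ) :
    t * besselSeries (α + 2) t - (α + 1) * besselSeries (α + 1) t + besselSeries α t = 0 := by
  have h0 := summable_besselSeries hα t
  have h1 := (summable_besselSeries (α := α + 1) (by linarith) t).mul_left (α + 1)
  have h2 := (h0.sub h1).tsum_eq_zero_add
  rw [h0.tsum_sub h1, tsum_mul_left] at h2
  have h3 : ∑' m : ℕ, ((-1) ^ (m + 1) * t ^ (m + 1) /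
        (((m + 1).factorial : ℝ) * Gamma (((m + 1 : ℕ) : ℝ) + α + 1)) -
        (α + 1) * ((-1) ^ (m + 1) * t ^ (m + 1) /
        (((m + 1).factorial : ℝ) * Gamma (((m + 1 : ℕ) : ℝ) + (α + 1) + 1)))) =
      -(t * besselSeries (α + 2) t) := by
    rw [besselSeries, ← tsum_mul_left, ← tsum_neg]
    refine tsum_congr fun m => ?_
    have hG := (Gamma_nat_add_pos hα (m + 1)).ne'
    have hm : (0 : ℝ) ≤ m := m.cast_nonneg
    have e1 : ((m + 1 : ℕ) : ℝ) + (α + 1) + 1 = ((m + 1 + 1 : ℕ) : ℝ) + α + 1 := by push_cast; ring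
    have e2 : (m : ℝ) + (α + 2) + 1 = ((m + 1 + 1 : ℕ) : ℝ) + α + 1 := by push_cast; ring
    have e3 : ((m + 1 : ℕ) : ℝ) + α + 1 ≠ 0 := by push_cast; linarith
    rw [e1, e2, Gamma_nat_succ_add hα (m + 1), Nat.factorial_succ]
    have : ((m + 1 : ℕ) : ℝ) ≠ 0 := by positivity
    push_cast at this e3 hG ⊢
    field_simp
    ring
  rw [h3] at h2
  have h4 : (-1 : ℝ) ^ 0 * t ^ 0 / (((0 : ℕ).factorial : ℝ) * Gamma (((0 : ℕ) : ℝ) + α + 1)) -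
      (α + 1) * ((-1 : ℝ) ^ 0 * t ^ 0 /
        (((0 : ℕ).factorial : ℝ) * Gamma (((0 : ℕ) : ℝ) + (α + 1) + 1))) = 0 := by
    have hG := Gamma_nat_succ_add hα 0
    have hG0 := (Gamma_nat_add_pos hα 0).ne'
    have : α + 1 ≠ 0 := by linarith
    simp only [zero_add, Nat.cast_one, CharP.cast_eq_zero] at hG hG0 ⊢
    rw [show α + 1 + 1 = 1 + α + 1 by ring, hG]
    simp; field_simp; simp
  rw [h4] at h2
  change besselSeries α t - (α + 1) * besselSeries (α + 1) t = _ at h2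
  linarith

/-- The energy `Λ² + t Λ'²` decreases, hence `Λ` is bounded by its value at `0`. -/
theorem abs_besselSeries_le {α : ℝ} (hα : -1 / 2 < α) {t : ℝ} (ht : 0 ≤ t) :
    |besselSeries α t| ≤ 1 / Gamma (α + 1) := by
  have hα' : -1 < α := by linarith
  -- By Bessel's equation the energy has derivative -(2α + 1) Λ'², which is where α > -1/2 enters.
  have hE : ∀ t, HasDerivAt (fun t => besselSeries α t ^ 2 + t * besselSeries (α + 1) t ^ 2)
      (-(2 * α + 1) * besselSeries (α + 1) t ^ 2) t := by
    intro t
    have h0 := hasDerivAt_besselSeries hα' t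
    have h1 := hasDerivAt_besselSeries (α := α + 1) (by linarith) t
    have h2 := (h0.pow 2).add ((hasDerivAt_id t).mul (h1.pow 2))
    refine h2.congr_deriv ?_
    have h3 := besselSeries_recurrence hα' t
    rw [show α + 1 + 1 = α + 2 by ring]
    simp only [id, Pi.pow_apply]
    push_cast
    linear_combination (-2 * besselSeries (α + 1) t) * h3
  have hanti : AntitoneOn (fun t => besselSeries α t ^ 2 + t * besselSeries (α + 1) t ^ 2)
      (Ici 0) := by
    refine antitoneOn_of_deriv_nonpos (convex_Ici 0)
      (fun t _ => (hE t).continuousAt.continuousWithinAt)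
      (fun t _ => (hE t).differentiableAt.differentiableWithinAt) fun t _ => ?_
    rw [(hE t).deriv]
    nlinarith [sq_nonneg (besselSeries (α + 1) t)]
  have h := hanti (mem_Ici.2 le_rfl) (mem_Ici.2 ht) ht
  simp only [zero_mul, add_zero] at h
  have h5 : besselSeries α t ^ 2 ≤ besselSeries α 0 ^ 2 := by
    nlinarith [mul_nonneg ht (sq_nonneg (besselSeries (α + 1) t))]
  have h6 := sq_le_sq.1 h5
  rwa [besselSeries_zero, abs_of_pos (one_div_pos.2 (Gamma_pos_of_pos (by linarith)))] at h6

theorem besselKernel_eq {α : ℝ} {t : ℝ} (ht : 0 ≤ t) :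
    besselKernel α t = besselSeries α t := by
  rcases ht.eq_or_lt with rfl | ht
  · rw [besselSeries_zero, besselKernel, if_pos rfl]
  · rw [besselKernel, if_neg ht.ne', besselJ, besselSeries, ← tsum_mul_left]
    refine tsum_congr fun m => ?_
    have h : t ^ (-α / 2) * (2 * √t / 2) ^ (2 * (m : ℝ) + α) = t ^ m := by
      rw [mul_div_cancel_left₀ _ two_ne_zero, Real.sqrt_eq_rpow, ← Real.rpow_mul ht.le,
        ← Real.rpow_add ht, ← Real.rpow_natCast]
      congr 1; ring
    rw [← h]; ring

/-! ### Transforms of t^j e^(-t), and Laguerre polynomials. -/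

/-- Induction step for Chu–Vandermonde: Pascal's rule, then a shift of index using C(j, i) (j - i) =
C(j, i+1) (i+1). -/
theorem sum_choose_succ_mul (j : ℕ) (a : ℝ) (q : ℕ → ℝ) :
    ∑ i ∈ Finset.range (j + 2), ((j + 1).choose i : ℝ) * ((j + a) * q i) =
      ∑ i ∈ Finset.range (j + 1), (j.choose i : ℝ) * ((i + a) * q (i + 1) + (i + j + a) * q i) := by
  have h1 : ∀ i ∈ Finset.range (j + 1), (j.choose i : ℝ) * (j - i) = j.choose (i + 1) * (i + 1) := by
    intro i hi
    have := Nat.choose_succ_right_eq j i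
    rw [← Nat.cast_sub (Nat.lt_succ_iff.1 (Finset.mem_range.1 hi))]
    exact_mod_cast this.symm
  have h2 : ∑ i ∈ Finset.range (j + 1), (j.choose i : ℝ) * (j - i) * q (i + 1) =
      ∑ i ∈ Finset.range (j + 1), (j.choose i : ℝ) * i * q i := by
    have h3 : ∑ i ∈ Finset.range (j + 2), (j.choose i : ℝ) * i * q i =
        ∑ i ∈ Finset.range (j + 1), (j.choose i : ℝ) * i * q i := by
      rw [Finset.sum_range_succ]; simp
    rw [← h3, Finset.sum_range_succ' _ (j + 1)]
    simp only [CharP.cast_eq_zero, mul_zero, zero_mul, add_zero]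
    refine Finset.sum_congr rfl fun i hi => ?_
    rw [h1 i hi]; push_cast; ring
  have h4 : ∑ i ∈ Finset.range (j + 1), (j.choose (i + 1) : ℝ) * ((j + a) * q (i + 1)) +
      (j + a) * q 0 = ∑ i ∈ Finset.range (j + 1), (j.choose i : ℝ) * ((j + a) * q i) := by
    have h5 : ∑ i ∈ Finset.range (j + 2), (j.choose i : ℝ) * ((j + a) * q i) =
        ∑ i ∈ Finset.range (j + 1), (j.choose i : ℝ) * ((j + a) * q i) := by
      rw [Finset.sum_range_succ]; simp
    rw [← h5, Finset.sum_range_succ' _ (j + 1)]; simp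
  rw [Finset.sum_range_succ' _ (j + 1)]
  simp only [Nat.choose_succ_succ, Nat.cast_add, add_mul, Finset.sum_add_distrib, mul_add,
    Nat.choose_zero_right, Nat.cast_one, one_mul] at h4 h2 ⊢
  simp only [mul_sub, sub_mul, Finset.sum_sub_distrib] at h2
  simp only [← mul_assoc] at h4 h2 ⊢
  linarith

/-- The Chu–Vandermonde identity in terms of Gamma functions. -/
theorem Gamma_ratio_eq_sum {α : ℝ} (hα : -1 < α) (m j : ℕ) :
    Gamma ((m + j : ℕ) + α + 1) / Gamma (m + α + 1) =
      ∑ i ∈ Finset.range (j + 1), (j.choose i : ℝ) *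
        (m.descFactorial i * (Gamma (j + α + 1) / Gamma (i + α + 1))) := by
  induction j with
  | zero =>
    have := (Gamma_nat_add_pos hα m).ne'
    have := (Gamma_nat_add_pos hα 0).ne'
    simp_all
  | succ j ih =>
    have h := sum_choose_succ_mul j (α + 1)
      (fun i => m.descFactorial i * Gamma (j + α + 1) / Gamma (i + α + 1))
    rw [← add_assoc, Gamma_nat_succ_add hα (m + j), mul_div_assoc, ih]
    trans ∑ i ∈ Finset.range (j + 2), ((j + 1).choose i : ℝ) *
      ((j + (α + 1)) * (m.descFactorial i * Gamma (j + α + 1) / Gamma (i + α + 1)))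
    -- The coefficients match because (m - i) + (i + j + α + 1) = m + j + α + 1, the factor m - i
    -- coming from the next falling factorial.
    · rw [h, Finset.mul_sum]
      refine Finset.sum_congr rfl fun i _ => ?_
      have hi : (0 : ℝ) ≤ i := i.cast_nonneg
      have hG := (Gamma_nat_add_pos hα i).ne'
      have h1 : (i : ℝ) + α + 1 ≠ 0 := by linarith
      have h2 : ((m.descFactorial (i + 1) : ℕ) : ℝ) = (m - i) * m.descFactorial i := by
        rw [Nat.descFactorial_succ]
        rcases le_or_gt i m with him | him
        · push_cast [Nat.cast_sub him]; ring
        · simp [Nat.descFactorial_eq_zero_iff_lt.2 him]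
      rw [Gamma_nat_succ_add hα i, h2]
      push_cast
      field_simp
      ring
    · refine Finset.sum_congr rfl fun i _ => ?_
      rw [Gamma_nat_succ_add hα j]; ring

theorem hasSum_pow_mul_descFactorial (z : ℝ) (i : ℕ) :
    HasSum (fun m : ℕ => z ^ m / m.factorial * m.descFactorial i) (z ^ i * exp z) := by
  rw [← hasSum_nat_add_iff' i]
  have h0 : ∑ m ∈ Finset.range i, z ^ m / m.factorial * (m.descFactorial i : ℝ) = 0 :=
    Finset.sum_eq_zero fun m hm => by
      simp [Nat.descFactorial_eq_zero_iff_lt.2 (Finset.mem_range.1 hm)]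
  rw [h0, sub_zero, Real.exp_eq_exp_ℝ]
  refine ((NormedSpace.expSeries_div_hasSum_exp z).mul_left (z ^ i)).congr_fun fun m => ?_
  have h := Nat.factorial_mul_descFactorial (Nat.le_add_left i m)
  rw [Nat.add_sub_cancel] at h
  have h' : (m.factorial : ℝ) * (m + i).descFactorial i = (m + i).factorial := by exact_mod_cast h
  have h1 : (m.factorial : ℝ) ≠ 0 := by positivity
  have h2 : ((m + i).factorial : ℝ) ≠ 0 := by positivity
  rw [← h'] at h2 ⊢
  have h3 : ((m + i).descFactorial i : ℝ) ≠ 0 := right_ne_zero_of_mul h2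
  field_simp
  ring

theorem factorial_mul_laguerre (α : ℝ) (j : ℕ) (x : ℝ) :
    j.factorial * laguerre α j x = ∑ i ∈ Finset.range (j + 1),
      (j.choose i : ℝ) * (Gamma (j + α + 1) / Gamma (i + α + 1)) * (-x) ^ i := by
  rw [laguerre, Finset.mul_sum]
  refine Finset.sum_congr rfl fun i hi => ?_
  rw [Nat.cast_choose ℝ (Nat.lt_succ_iff.1 (Finset.mem_range.1 hi)), neg_pow x]
  field_simp

/-- Chu–Vandermonde writes the Gamma ratio through falling factorials of m; each of these sums to
(-x)^i e^(-x), and what multiplies e^(-x) is j! L_j. -/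
theorem hasSum_Gamma_ratio {α : ℝ} (hα : -1 < α) (j : ℕ) (x : ℝ) :
    HasSum (fun m : ℕ => (-x) ^ m / m.factorial * (Gamma ((m + j : ℕ) + α + 1) / Gamma (m + α + 1)))
      (j.factorial * (laguerre α j x * exp (-x))) := by
  have h : HasSum (fun m : ℕ => ∑ i ∈ Finset.range (j + 1), (j.choose i : ℝ) *
      (Gamma (j + α + 1) / Gamma (i + α + 1)) * ((-x) ^ m / m.factorial * m.descFactorial i)) _ :=
    hasSum_sum fun i _ => (hasSum_pow_mul_descFactorial (-x) i).mul_left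
      ((j.choose i : ℝ) * (Gamma (j + α + 1) / Gamma (i + α + 1)))
  convert! h using 1
  · funext m
    rw [Gamma_ratio_eq_sum hα, Finset.mul_sum]
    exact Finset.sum_congr rfl fun i _ => by ring
  · rw [← mul_assoc, factorial_mul_laguerre, Finset.sum_mul]
    exact Finset.sum_congr rfl fun i _ => by ring

theorem integrableOn_pow_mul_exp {α : ℝ} (hα : -1 < α) (j : ℕ) :
    IntegrableOn (fun t : ℝ => t ^ j * exp (-t) * t ^ α) (Ioi 0) := by
  have hj : (0 : ℝ) ≤ j := j.cast_nonneg
  refine (GammaIntegral_convergent (s := j + α + 1) (by linarith)).congr_fun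
    (fun t (ht : 0 < t) => ?_) measurableSet_Ioi
  simp only [add_sub_cancel_right]
  rw [rpow_add ht, rpow_natCast]; ring

theorem integral_pow_mul_exp {α : ℝ} (hα : -1 < α) (j : ℕ) :
    ∫ t in Ioi (0 : ℝ), t ^ j * exp (-t) * t ^ α = Gamma (j + α + 1) := by
  have hj : (0 : ℝ) ≤ j := j.cast_nonneg
  rw [Gamma_eq_integral (by linarith)]
  refine setIntegral_congr_fun measurableSet_Ioi fun t (ht : 0 < t) => ?_
  simp only [add_sub_cancel_right]
  rw [rpow_add ht, rpow_natCast]; ring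

/-- Integrate the power series term by term; each term is a Gamma integral. -/
theorem integral_besselSeries_mul_pow {α : ℝ} (hα : -1 < α) (j : ℕ) (x : ℝ) :
    ∫ t in Ioi (0 : ℝ), besselSeries α (t * x) * (t ^ j * exp (-t) * t ^ α) =
      j.factorial * (laguerre α j x * exp (-x)) := by
  set c : ℕ → ℝ := fun m => (-x) ^ m / (m.factorial * Gamma (m + α + 1)) with hc
  have hint : ∀ m, ∫ t in Ioi (0 : ℝ), c m * (t ^ (m + j) * exp (-t) * t ^ α) =
      (-x) ^ m / m.factorial * (Gamma ((m + j : ℕ) + α + 1) / Gamma (m + α + 1)) := by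
    intro m
    rw [integral_const_mul, integral_pow_mul_exp hα, hc]
    ring
  -- The L¹ norms form the same series at -|x|, so `hasSum_Gamma_ratio` also gives the summability
  -- that justifies the exchange.
  have hnorm : ∀ m, ∫ t in Ioi (0 : ℝ), ‖c m * (t ^ (m + j) * exp (-t) * t ^ α)‖ =
      (-(-|x|)) ^ m / m.factorial * (Gamma ((m + j : ℕ) + α + 1) / Gamma (m + α + 1)) := by
    intro m
    have : ∀ t ∈ Ioi (0 : ℝ), ‖c m * (t ^ (m + j) * exp (-t) * t ^ α)‖ =
        |c m| * (t ^ (m + j) * exp (-t) * t ^ α) := by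
      intro t (ht : 0 < t)
      rw [norm_mul, Real.norm_eq_abs, Real.norm_of_nonneg (by positivity)]
    rw [setIntegral_congr_fun measurableSet_Ioi this, integral_const_mul, integral_pow_mul_exp hα,
      hc]
    have hG := Gamma_nat_add_pos hα m
    simp only
    rw [abs_div, abs_pow, abs_neg, abs_of_pos (mul_pos (by positivity) hG), neg_neg]
    ring
  have h := hasSum_integral_of_summable_integral_norm
    (F := fun m t => c m * (t ^ (m + j) * exp (-t) * t ^ α)) (μ := volume.restrict (Ioi 0))
    (fun m => (integrableOn_pow_mul_exp hα (m + j)).const_mul (c m))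
    (by simp_rw [hnorm]; exact (hasSum_Gamma_ratio hα j (-|x|)).summable)
  simp_rw [hint] at h
  rw [(hasSum_Gamma_ratio hα j x).unique h]
  refine setIntegral_congr_fun measurableSet_Ioi fun t (ht : 0 < t) => ?_
  rw [besselSeries, ← tsum_mul_right]
  refine tsum_congr fun m => ?_
  simp only [hc]
  rw [neg_pow x, mul_pow, pow_add]
  ring

theorem integrableOn_laguerre {α : ℝ} (hα : -1 < α) (j : ℕ) :
    IntegrableOn (fun t : ℝ => laguerre α j t * exp (-t) * t ^ α) (Ioi 0) := by
  simp only [laguerre, Finset.sum_mul]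
  refine integrable_finsetSum _ fun i _ => ?_
  refine ((integrableOn_pow_mul_exp hα i).const_mul ((-1) ^ i *
    (Gamma (j + α + 1) / ((j - i).factorial * Gamma (i + α + 1))) / i.factorial)).congr
    (ae_of_all _ fun t => ?_)
  simp only
  ring

theorem continuous_laguerre (α : ℝ) (j : ℕ) : Continuous (laguerre α j) := by
  unfold laguerre
  fun_prop

theorem sum_alternating_inv_factorial (n : ℕ) :
    ∑ k ∈ Finset.range (n + 1), (-1 : ℝ) ^ k / ((n - k).factorial * k.factorial) =
      if n = 0 then 1 else 0 := by
  have h : ((∑ k ∈ Finset.range (n + 1), (-1 : ℤ) ^ k * n.choose k : ℤ) : ℝ) =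
      ((if n = 0 then 1 else 0 : ℤ) : ℝ) := by rw [Int.alternating_sum_range_choose]
  push_cast at h
  have h2 : ∑ k ∈ Finset.range (n + 1), (-1 : ℝ) ^ k / ((n - k).factorial * k.factorial) =
      (∑ k ∈ Finset.range (n + 1), (-1 : ℝ) ^ k * n.choose k) / n.factorial := by
    rw [Finset.sum_div]
    refine Finset.sum_congr rfl fun k hk => ?_
    rw [Nat.cast_choose ℝ (Nat.lt_succ_iff.1 (Finset.mem_range.1 hk))]
    field_simp
  rw [h2, h]
  split_ifs with hn <;> simp [hn]

/-- Expansion of a monomial in Laguerre polynomials. -/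
theorem sum_laguerre_eq_pow {α : ℝ} (hα : -1 < α) (j : ℕ) (s : ℝ) :
    ∑ i ∈ Finset.range (j + 1),
      (-1) ^ i * (Gamma (j + α + 1) / ((j - i).factorial * Gamma (i + α + 1))) * laguerre α i s =
      s ^ j / j.factorial := by
  simp only [laguerre, Finset.mul_sum]
  rw [Finset.sum_comm' (t' := Finset.range (j + 1)) (s' := fun l => Finset.Ico l (j + 1))
    (by intro i l; simp only [Finset.mem_range, Finset.mem_Ico]; omega)]
  -- The coefficient of s^l is an alternating binomial sum of length j - l + 1, which vanishes
  -- unless l = j.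
  have h : ∀ l ∈ Finset.range (j + 1), ∑ i ∈ Finset.Ico l (j + 1),
      (-1) ^ i * (Gamma (j + α + 1) / ((j - i).factorial * Gamma (i + α + 1))) *
        ((-1) ^ l * (Gamma (i + α + 1) / ((i - l).factorial * Gamma (l + α + 1))) *
        (s ^ l / l.factorial)) =
      Gamma (j + α + 1) / Gamma (l + α + 1) * (s ^ l / l.factorial) * if j - l = 0 then 1 else 0 := by
    intro l hl
    have hl' := Nat.lt_succ_iff.1 (Finset.mem_range.1 hl)
    rw [← sum_alternating_inv_factorial, Finset.sum_Ico_eq_sum_range, Nat.succ_sub hl',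
      Finset.mul_sum]
    refine Finset.sum_congr rfl fun k _ => ?_
    have hG := (Gamma_nat_add_pos hα (l + k)).ne'
    have h1 : ((-1 : ℝ) ^ l) * (-1) ^ l = 1 := by rw [← mul_pow]; simp
    rw [Nat.add_sub_cancel_left, ← Nat.sub_sub, pow_add]
    field_simp
    rw [sq, h1, one_mul]
  rw [Finset.sum_congr rfl h, Finset.sum_eq_single j]
  · have hG := (Gamma_nat_add_pos hα j).ne'
    simp [hG]
  · intro l hl hlj
    have hl' := Finset.mem_range.1 hl
    rw [if_neg (by omega), mul_zero]
  · simp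

/-! ### Bounds, continuity and Fubini for integrals of the kernel. -/

section Transform

variable {α : ℝ} {μ ν : Measure ℝ} {φ ψ : ℝ → ℝ}

theorem norm_besselSeries_mul_le (hα : -1 / 2 < α) {t : ℝ} (ht : 0 ≤ t) (r : ℝ) :
    ‖besselSeries α t * r‖ ≤ 1 / Gamma (α + 1) * ‖r‖ := by
  rw [norm_mul]
  exact mul_le_mul_of_nonneg_right (abs_besselSeries_le hα ht) (norm_nonneg r)

theorem integrable_besselSeries_mul (hα : -1 / 2 < α) (hμ : ∀ᵐ x ∂μ, 0 ≤ x) (hφ : Integrable φ μ)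
    {s : ℝ} (hs : 0 ≤ s) : Integrable (fun x => besselSeries α (x * s) * φ x) μ := by
  have hc := continuous_besselSeries (α := α) (by linarith)
  refine (hφ.norm.const_mul (1 / Gamma (α + 1))).mono'
    ((by fun_prop : Continuous fun x => besselSeries α (x * s)).aestronglyMeasurable.mul hφ.1) ?_
  filter_upwards [hμ] with x hx using norm_besselSeries_mul_le hα (mul_nonneg hx hs) _

theorem abs_integral_besselSeries_mul_le (hα : -1 / 2 < α) (hμ : ∀ᵐ x ∂μ, 0 ≤ x)
    (hφ : Integrable φ μ) {s : ℝ} (hs : 0 ≤ s) :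
    |∫ x, besselSeries α (x * s) * φ x ∂μ| ≤ 1 / Gamma (α + 1) * ∫ x, ‖φ x‖ ∂μ := by
  rw [← integral_const_mul, ← Real.norm_eq_abs]
  refine norm_integral_le_of_norm_le (hφ.norm.const_mul _) ?_
  filter_upwards [hμ] with x hx using norm_besselSeries_mul_le hα (mul_nonneg hx hs) _

theorem continuousOn_integral_besselSeries_mul (hα : -1 / 2 < α) (hμ : ∀ᵐ x ∂μ, 0 ≤ x)
    (hφ : Integrable φ μ) :
    ContinuousOn (fun s => ∫ x, besselSeries α (x * s) * φ x ∂μ) (Ici 0) := by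
  have hc := continuous_besselSeries (α := α) (by linarith)
  refine continuousOn_of_dominated (bound := fun x => 1 / Gamma (α + 1) * ‖φ x‖)
    (fun s hs => (integrable_besselSeries_mul hα hμ hφ hs).1) (fun s hs => ?_)
    (hφ.norm.const_mul _) (ae_of_all _ fun x => ?_)
  · filter_upwards [hμ] with x hx using norm_besselSeries_mul_le hα (mul_nonneg hx hs) _
  · exact Continuous.continuousOn (by fun_prop)

/-- General measures serve two purposes: Lebesgue measure on both sides gives the symmetry of H, and
a finite representing measure on one side gives the converse direction. -/
theorem integral_mul_integral_besselSeries_swap [SFinite μ] [SFinite ν] (hα : -1 / 2 < α)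
    (hμ : ∀ᵐ x ∂μ, 0 ≤ x) (hν : ∀ᵐ x ∂ν, 0 ≤ x) (hφ : Integrable φ μ) (hψ : Integrable ψ ν) :
    ∫ x, φ x * ∫ s, besselSeries α (s * x) * ψ s ∂ν ∂μ =
      ∫ s, ψ s * ∫ x, besselSeries α (x * s) * φ x ∂μ ∂ν := by
  have hc := continuous_besselSeries (α := α) (by linarith)
  simp_rw [← integral_const_mul]
  rw [integral_integral_swap]
  · refine integral_congr_ae (ae_of_all _ fun s => integral_congr_ae (ae_of_all _ fun x => ?_))
    simp only
    rw [mul_comm s x]; ring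
  · have hprod := hφ.mul_prod hψ
    refine (hprod.norm.const_mul (1 / Gamma (α + 1))).mono' ?_ ?_
    · have h : AEStronglyMeasurable (fun z : ℝ × ℝ => besselSeries α (z.2 * z.1)) (μ.prod ν) :=
        (by fun_prop : Continuous fun z : ℝ × ℝ => besselSeries α (z.2 * z.1)).aestronglyMeasurable
      refine (h.mul hprod.1).congr (ae_of_all _ fun z => ?_)
      simp only [Pi.mul_apply, Function.uncurry]
      ring
    · have h1 : ∀ᵐ z ∂μ.prod ν, 0 ≤ z.1 := Measure.quasiMeasurePreserving_fst.ae hμ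
      have h2 : ∀ᵐ z ∂μ.prod ν, 0 ≤ z.2 := Measure.quasiMeasurePreserving_snd.ae hν
      filter_upwards [h1, h2] with z hz1 hz2
      refine le_trans (le_of_eq ?_) (norm_besselSeries_mul_le hα (mul_nonneg hz2 hz1) _)
      simp only [Function.uncurry]
      congr 1
      ring

end Transform

/-! ### The Hankel transform: symmetry, explicit values, scaling. -/

theorem ae_restrict_Ioi_nonneg : ∀ᵐ x ∂(volume.restrict (Ioi (0 : ℝ))), 0 ≤ x := by
  filter_upwards [ae_restrict_mem measurableSet_Ioi] with x hx using le_of_lt hx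

/-- The Hankel transform for the kernel `(x s)^(-α/2) J_α(2 √(x s))` and the measure `x^α dx`. -/
def hankel (α : ℝ) (φ : ℝ → ℝ) (s : ℝ) : ℝ :=
  ∫ x in Ioi (0 : ℝ), besselSeries α (x * s) * (φ x * x ^ α)

theorem integral_mul_hankel_swap {α : ℝ} {φ ψ : ℝ → ℝ} (hα : -1 / 2 < α)
    (hφ : IntegrableOn (fun x => φ x * x ^ α) (Ioi 0))
    (hψ : IntegrableOn (fun x => ψ x * x ^ α) (Ioi 0)) :
    ∫ x in Ioi (0 : ℝ), φ x * x ^ α * hankel α ψ x =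
      ∫ x in Ioi (0 : ℝ), ψ x * x ^ α * hankel α φ x :=
  integral_mul_integral_besselSeries_swap hα ae_restrict_Ioi_nonneg ae_restrict_Ioi_nonneg hφ hψ

theorem hankel_pow_mul_exp {α : ℝ} (hα : -1 < α) (j : ℕ) (x : ℝ) :
    hankel α (fun t => t ^ j * exp (-t)) x = j.factorial * (laguerre α j x * exp (-x)) :=
  integral_besselSeries_mul_pow hα j x

/-- Linearity reduces this to the transforms of t^i e^(-t); the resulting combination of Laguerre
polynomials is a monomial by `sum_laguerre_eq_pow`. -/
theorem hankel_laguerre_mul_exp {α : ℝ} (hα : -1 / 2 < α) (j : ℕ) {s : ℝ} (hs : 0 ≤ s) :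
    hankel α (fun t => laguerre α j t * exp (-t)) s = s ^ j * exp (-s) / j.factorial := by
  have hα' : -1 < α := by linarith
  set c : ℕ → ℝ := fun i => (-1) ^ i * (Gamma (j + α + 1) / ((j - i).factorial * Gamma (i + α + 1)))
    with hc
  have h1 : hankel α (fun t => laguerre α j t * exp (-t)) s = ∫ t in Ioi (0 : ℝ),
      ∑ i ∈ Finset.range (j + 1),
        c i / i.factorial * (besselSeries α (t * s) * (t ^ i * exp (-t) * t ^ α)) := by
    refine setIntegral_congr_fun measurableSet_Ioi fun t _ => ?_
    simp only [laguerre, Finset.sum_mul, Finset.mul_sum]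
    refine Finset.sum_congr rfl fun i _ => ?_
    rw [hc]; ring
  rw [h1, integral_finsetSum _ fun i _ => (integrable_besselSeries_mul hα ae_restrict_Ioi_nonneg
    (integrableOn_pow_mul_exp hα' i) hs).const_mul _]
  simp_rw [integral_const_mul, integral_besselSeries_mul_pow hα']
  rw [div_eq_mul_inv, mul_right_comm, ← div_eq_mul_inv, ← sum_laguerre_eq_pow hα', Finset.sum_mul]
  refine Finset.sum_congr rfl fun i _ => ?_
  rw [hc]; field_simp

theorem hankel_comp_mul {α : ℝ} {φ : ℝ → ℝ} {y : ℝ} (hy : 0 < y) (s : ℝ) :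
    hankel α (fun x => φ (y * x)) s = y ^ (-α - 1) * hankel α φ (s / y) := by
  have h := integral_comp_mul_left_Ioi
    (fun x => besselSeries α (x * (s / y)) * (φ x * x ^ α)) 0 hy
  rw [mul_zero, smul_eq_mul] at h
  rw [hankel, hankel, sub_eq_add_neg, rpow_add hy, rpow_neg_one, mul_assoc, ← h,
    ← integral_const_mul]
  refine setIntegral_congr_fun measurableSet_Ioi fun x (hx : 0 < x) => ?_
  rw [mul_rpow hy.le hx.le, rpow_neg hy.le, show y * x * (s / y) = x * s by field_simp]
  have := (rpow_pos_of_pos hy α).ne'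
  field_simp

theorem integrableOn_comp_mul {α : ℝ} {φ : ℝ → ℝ} {y : ℝ} (hy : 0 < y)
    (hφ : IntegrableOn (fun x => φ x * x ^ α) (Ioi 0)) :
    IntegrableOn (fun x => φ (y * x) * x ^ α) (Ioi 0) := by
  have h := (integrableOn_Ioi_comp_mul_left_iff (fun x => φ x * x ^ α) 0 hy).2 (by simpa using hφ)
  refine IntegrableOn.congr_fun (h.const_mul (y ^ α)⁻¹) (fun x (hx : 0 < x) => ?_) measurableSet_Ioi
  rw [mul_rpow hy.le hx.le]
  have := (rpow_pos_of_pos hy α).ne'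
  field_simp

/-! ### Concentration of Gamma densities. -/

theorem integrableOn_comp_mul_gamma {α : ℝ} (hα : -1 < α) {h : ℝ → ℝ} {M : ℝ}
    (hc : ContinuousOn h (Ioi 0)) (hM : ∀ x, 0 < x → |h x| ≤ M) {y : ℝ} (hy : 0 < y) (j : ℕ) :
    IntegrableOn (fun t => h (y * t) * (t ^ j * exp (-t) * t ^ α)) (Ioi 0) := by
  refine (integrableOn_pow_mul_exp hα j).bdd_mul (c := M) ?_ ?_
  · exact ContinuousOn.aestronglyMeasurable (hc.comp (by fun_prop) fun t ht => mul_pos hy ht)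
      measurableSet_Ioi
  · filter_upwards [ae_restrict_mem measurableSet_Ioi] with t ht using hM _ (mul_pos hy ht)

/-- Positivity from Gamma averages: a bounded continuous function on `(0, ∞)` all of whose averages
against scaled Gamma densities are nonnegative is nonnegative. -/
theorem nonneg_of_gamma_averages_nonneg {α : ℝ} (hα : -1 < α) {h : ℝ → ℝ} {M : ℝ}
    (hc : ContinuousOn h (Ioi 0)) (hM : ∀ x, 0 < x → |h x| ≤ M)
    (hh : ∀ y, 0 < y → ∀ j : ℕ, 0 ≤ ∫ t in Ioi (0 : ℝ), h (y * t) * (t ^ j * exp (-t) * t ^ α))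
    {x : ℝ} (hx : 0 < x) : 0 ≤ h x := by
  by_contra! hneg
  set c := -h x / 2 with hcdef
  have hcpos : 0 < c := by linarith
  have hM0 : 0 ≤ M := (abs_nonneg _).trans (hM x hx)
  obtain ⟨η, hη, hη'⟩ := Metric.continuousAt_iff.1 (hc.continuousAt (Ioi_mem_nhds hx)) c hcpos
  set K := (M + c) / η ^ 2 with hK
  have hK0 : 0 ≤ K := by positivity
  -- A parabola majorant, as in Chebyshev's inequality: near x continuity gives h < -c, since h x =
  -- -2c; at distance at least η the quadratic term exceeds M + c.
  have hmaj : ∀ u, 0 < u → h u ≤ -c + K * (u - x) ^ 2 := by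
    intro u hu
    rcases lt_or_ge |u - x| η with hux | hux
    · have h1 := hη' (x := u) (by rwa [Real.dist_eq])
      rw [Real.dist_eq] at h1
      have h2 := (abs_lt.1 h1).2
      have h3 : 0 ≤ K * (u - x) ^ 2 := by positivity
      linarith
    · have h1 : η ^ 2 ≤ (u - x) ^ 2 := by
        rw [← sq_abs (u - x)]; gcongr
      have h2 : M + c ≤ K * (u - x) ^ 2 := by
        calc M + c = K * η ^ 2 := by rw [hK]; field_simp
          _ ≤ _ := by gcongr
      have h3 := (abs_le.1 (hM u hu)).2
      linarith
  -- At scale x / a the Gamma law of shape a has mean x and variance x² / a, so the average of the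
  -- majorant is -c + K x² / a, negative once a > K x² / c.
  obtain ⟨j, hj⟩ := exists_nat_gt (K * x ^ 2 / c + 1)
  set a : ℝ := j + α + 1 with ha
  have haj : K * x ^ 2 / c < a := by linarith
  have ha0 : 0 < a := lt_of_le_of_lt (by positivity) haj
  have hG : 0 < Gamma a := Gamma_pos_of_pos ha0
  have i0 := (integrableOn_pow_mul_exp hα j).const_mul (-c + K * x ^ 2)
  have i1 := (integrableOn_pow_mul_exp hα (j + 1)).const_mul (2 * K * x ^ 2 / a)
  have i2 := (integrableOn_pow_mul_exp hα (j + 2)).const_mul (K * x ^ 2 / a ^ 2)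
  have i01 : IntegrableOn (fun t => (-c + K * x ^ 2) * (t ^ j * exp (-t) * t ^ α) -
      2 * K * x ^ 2 / a * (t ^ (j + 1) * exp (-t) * t ^ α)) (Ioi 0) := i0.sub i1
  have key : ∫ t in Ioi (0 : ℝ), h (x / a * t) * (t ^ j * exp (-t) * t ^ α) ≤
      ∫ t in Ioi (0 : ℝ), ((-c + K * x ^ 2) * (t ^ j * exp (-t) * t ^ α) -
        2 * K * x ^ 2 / a * (t ^ (j + 1) * exp (-t) * t ^ α) +
        K * x ^ 2 / a ^ 2 * (t ^ (j + 2) * exp (-t) * t ^ α)) := by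
    refine setIntegral_mono_on (integrableOn_comp_mul_gamma hα hc hM (by positivity) j)
      (i01.add i2) measurableSet_Ioi fun t (ht : 0 < t) => ?_
    have h1 := hmaj (x / a * t) (by positivity)
    have h2 : 0 ≤ t ^ j * exp (-t) * t ^ α := by positivity
    refine (mul_le_mul_of_nonneg_right h1 h2).trans (le_of_eq ?_)
    field_simp
    ring
  rw [integral_add i01 i2, integral_sub i0 i1, integral_const_mul, integral_const_mul,
    integral_const_mul, integral_pow_mul_exp hα, integral_pow_mul_exp hα, integral_pow_mul_exp hα,
    Gamma_nat_succ_add hα (j + 1), Gamma_nat_succ_add hα j] at key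
  have h1 := (hh (x / a) (by positivity) j).trans key
  push_cast at h1
  have h2 : (-c + K * x ^ 2) * Gamma (j + α + 1) -
      2 * K * x ^ 2 / a * ((j + α + 1) * Gamma (j + α + 1)) +
      K * x ^ 2 / a ^ 2 * ((j + 1 + α + 1) * ((j + α + 1) * Gamma (j + α + 1))) =
      Gamma a * (-c + K * x ^ 2 / a) := by
    rw [show (j : ℝ) + 1 + α + 1 = a + 1 by rw [ha]; ring, ← ha]
    field_simp
    ring
  rw [h2] at h1
  have h3 : K * x ^ 2 / a < c := by
    rw [div_lt_iff₀ ha0]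
    rw [div_lt_iff₀ hcpos] at haj
    linarith
  nlinarith

/-! ### Consequences of the decay bound; positivity of the normalising integral. -/

theorem abs_le_of_decay {α C ε : ℝ} {f : ℝ → ℝ} (hα : -1 < α) (hC : 0 < C) (hε : 0 < ε)
    (h : ∀ x, 0 ≤ x → |f x| ≤ C * (1 + |x|) ^ (-α - 1 - ε)) {x : ℝ} (hx : 0 ≤ x) : |f x| ≤ C := by
  refine (h x hx).trans (mul_le_of_le_one_right hC.le ?_)
  exact rpow_le_one_of_one_le_of_nonpos (by linarith [abs_nonneg x]) (by linarith)

theorem integrableOn_mul_rpow_of_decay {α C ε : ℝ} {f : ℝ → ℝ} (hα : -1 < α)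
    (hf : ContinuousOn f (Ici 0)) (hC : 0 < C) (hε : 0 < ε)
    (h : ∀ x, 0 ≤ x → |f x| ≤ C * (1 + |x|) ^ (-α - 1 - ε)) :
    IntegrableOn (fun x => f x * x ^ α) (Ioi 0) := by
  have hmeas : ∀ s ⊆ Ioi (0 : ℝ), MeasurableSet s →
      AEStronglyMeasurable (fun x => f x * x ^ α) (volume.restrict s) := fun s hs hm =>
    ((hf.mono (hs.trans Ioi_subset_Ici_self)).mul
      (continuousOn_id.rpow_const fun x hx => Or.inl (hs hx).ne')).aestronglyMeasurable hm
  rw [← Ioc_union_Ioi_eq_Ioi (zero_le_one' ℝ), integrableOn_union]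
  constructor
  · have hi : IntegrableOn (fun x : ℝ => C * x ^ α) (Ioc 0 1) :=
      ((intervalIntegrable_iff_integrableOn_Ioc_of_le zero_le_one).1
        (intervalIntegral.intervalIntegrable_rpow' hα)).const_mul C
    refine Integrable.mono' hi (hmeas _ Ioc_subset_Ioi_self measurableSet_Ioc) ?_
    filter_upwards [ae_restrict_mem measurableSet_Ioc] with x hx
    have hx0 := rpow_nonneg hx.1.le α
    rw [norm_mul, Real.norm_eq_abs, Real.norm_of_nonneg hx0]
    exact mul_le_mul_of_nonneg_right (abs_le_of_decay hα hC hε h hx.1.le) hx0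
  · have hi : IntegrableOn (fun x : ℝ => C * x ^ (-1 - ε)) (Ioi 1) :=
      (integrableOn_Ioi_rpow_of_lt (by linarith) one_pos).const_mul C
    refine Integrable.mono' hi (hmeas _ (Ioi_subset_Ioi zero_le_one) measurableSet_Ioi) ?_
    filter_upwards [ae_restrict_mem measurableSet_Ioi] with x hx
    have hx0 : 0 < x := one_pos.trans hx
    have hxα := rpow_nonneg hx0.le α
    rw [norm_mul, Real.norm_eq_abs, Real.norm_of_nonneg hxα]
    calc |f x| * x ^ α ≤ C * (1 + |x|) ^ (-α - 1 - ε) * x ^ α :=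
          mul_le_mul_of_nonneg_right (h x hx0.le) hxα
      _ ≤ C * x ^ (-α - 1 - ε) * x ^ α := by
          refine mul_le_mul_of_nonneg_right (mul_le_mul_of_nonneg_left ?_ hC.le) hxα
          exact rpow_le_rpow_of_nonpos hx0 (by rw [abs_of_pos hx0]; linarith) (by linarith)
      _ = C * x ^ (-1 - ε) := by
          rw [mul_assoc, ← rpow_add hx0]; ring_nf

theorem laguerre_apply_zero_pos {α : ℝ} (hα : -1 < α) (j : ℕ) : 0 < laguerre α j 0 := by
  rw [laguerre, Finset.sum_eq_single 0 (fun i _ hi => by simp [hi]) (by simp)]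
  have h1 := Gamma_nat_add_pos hα j
  have h2 := Gamma_nat_add_pos hα 0
  simp only [pow_zero, Nat.factorial_zero, Nat.cast_one, div_one, one_mul, mul_one]
  positivity

theorem integral_laguerre_sq_pos {α : ℝ} (hα : -1 < α) (j : ℕ) :
    0 < ∫ x in Ioi (0 : ℝ), laguerre α j x ^ 2 * x ^ α * exp (-x) := by
  have hint : IntegrableOn (fun x : ℝ => laguerre α j x ^ 2 * x ^ α * exp (-x)) (Ioi 0) := by
    simp only [laguerre, sq, Finset.mul_sum, Finset.sum_mul]
    refine integrable_finsetSum _ fun i _ => integrable_finsetSum _ fun l _ => ?_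
    refine ((integrableOn_pow_mul_exp hα (i + l)).const_mul
      (((-1) ^ i * (Gamma (j + α + 1) / ((j - i).factorial * Gamma (i + α + 1))) / i.factorial) *
      ((-1) ^ l * (Gamma (j + α + 1) / ((j - l).factorial * Gamma (l + α + 1))) /
        l.factorial))).congr (ae_of_all _ fun t => ?_)
    simp only [pow_add]
    ring
  rw [setIntegral_pos_iff_support_of_nonneg_ae ?_ hint]
  -- Since L_j(0) > 0, the integrand is nonzero on some interval (0, δ).
  · have hev : ∀ᶠ x in 𝓝 (0 : ℝ), 0 < laguerre α j x :=
      (continuous_laguerre α j).continuousAt.eventually_const_lt (laguerre_apply_zero_pos hα j)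
    obtain ⟨δ, hδ, hpos⟩ := Metric.eventually_nhds_iff.1 hev
    refine lt_of_lt_of_le ?_ (measure_mono (s := Ioo 0 δ) fun x hx => ⟨?_, hx.1⟩)
    · simp [hδ]
    · have h1 := hpos (y := x) (by rw [Real.dist_eq, sub_zero, abs_of_pos hx.1]; exact hx.2)
      have h2 : 0 < x := hx.1
      exact (by positivity : 0 < laguerre α j x ^ 2 * x ^ α * exp (-x)).ne'
  · filter_upwards [ae_restrict_mem measurableSet_Ioi] with x (hx : 0 < x)
    simp only [Pi.zero_apply]
    positivity

theorem laguerreCoeff_nonneg_iff {α : ℝ} (hα : -1 < α) (h : ℝ → ℝ) (j : ℕ) :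
    0 ≤ laguerreCoeff α h j ↔
      0 ≤ ∫ x in Ioi (0 : ℝ), h x * laguerre α j x * x ^ α * exp (-x) := by
  have := integral_laguerre_sq_pos hα j
  refine ⟨fun h0 => ?_, fun h0 => div_nonneg h0 this.le⟩
  by_contra! hneg
  exact absurd h0 (not_le.2 (div_neg_of_neg_of_pos hneg this))

/-! ### From a representing measure to positive coefficients. -/

/-- The Laguerre coefficients of a Hankel transform of a positive measure. -/
theorem integral_laguerre_nonneg_of_measure {α : ℝ} (hα : -1 / 2 < α) {f : ℝ → ℝ} {μ : Measure ℝ}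
    [IsFiniteMeasure μ] (hμ : ∀ᵐ s ∂μ, 0 ≤ s)
    (hf : ∀ x, 0 ≤ x → f x = ∫ s, besselSeries α (s * x) ∂μ) {y : ℝ} (hy : 0 < y) (j : ℕ) :
    0 ≤ ∫ x in Ioi (0 : ℝ), f (x / y) * laguerre α j x * x ^ α * exp (-x) := by
  have hα' : -1 < α := by linarith
  -- Substituting x ↦ y x moves the scale from f to the Laguerre function, so that the
  -- representation of f applies directly.
  have h1 := integral_comp_mul_left_Ioi
    (fun x => f (x / y) * laguerre α j x * x ^ α * exp (-x)) 0 hy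
  rw [mul_zero, smul_eq_mul] at h1
  have h2 : ∫ x in Ioi (0 : ℝ), f (y * x / y) * laguerre α j (y * x) * (y * x) ^ α * exp (-(y * x)) =
      y ^ α * ∫ x in Ioi (0 : ℝ), laguerre α j (y * x) * exp (-(y * x)) * x ^ α *
        ∫ s, besselSeries α (s * x) * 1 ∂μ := by
    rw [← integral_const_mul]
    refine setIntegral_congr_fun measurableSet_Ioi fun x (hx : 0 < x) => ?_
    simp only [mul_one]
    rw [mul_div_cancel_left₀ x hy.ne', hf x hx.le, mul_rpow hy.le hx.le]
    ring
  have h3 := integral_mul_integral_besselSeries_swap hα ae_restrict_Ioi_nonneg hμ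
    (integrableOn_comp_mul (φ := fun t => laguerre α j t * exp (-t)) hy (integrableOn_laguerre hα' j))
    (integrable_const (1 : ℝ))
  rw [h2, h3] at h1
  have h4 : 0 ≤ ∫ s, 1 * ∫ x in Ioi (0 : ℝ),
      besselSeries α (x * s) * (laguerre α j (y * x) * exp (-(y * x)) * x ^ α) ∂volume ∂μ := by
    refine integral_nonneg_of_ae ?_
    filter_upwards [hμ] with s hs
    -- The inner integral is y^(-α-1) (s/y)^j e^(-s/y) / j!, visibly nonnegative.
    have h5 := hankel_comp_mul (α := α) (φ := fun t => laguerre α j t * exp (-t)) hy s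
    rw [hankel_laguerre_mul_exp hα j (by positivity), hankel] at h5
    rw [h5, Pi.zero_apply]
    positivity
  have h6 := mul_nonneg (rpow_nonneg hy.le α) h4
  rw [h1] at h6
  exact nonneg_of_mul_nonneg_right h6 (inv_pos.2 hy)

/-! ### From positive coefficients to a positive integrable transform, and inversion. -/

section Forward

variable {α M : ℝ} {f : ℝ → ℝ}

theorem continuousOn_hankel (hα : -1 / 2 < α) (hf : IntegrableOn (fun x => f x * x ^ α) (Ioi 0)) :
    ContinuousOn (hankel α f) (Ici 0) :=
  continuousOn_integral_besselSeries_mul hα ae_restrict_Ioi_nonneg hf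

theorem exists_abs_hankel_le (hα : -1 / 2 < α) (hf : IntegrableOn (fun x => f x * x ^ α) (Ioi 0)) :
    ∃ B, ∀ s, 0 ≤ s → |hankel α f s| ≤ B :=
  ⟨_, fun _ hs => abs_integral_besselSeries_mul_le hα ae_restrict_Ioi_nonneg hf hs⟩

/-- Laguerre coefficients are Gamma averages of the Hankel transform. -/
theorem integral_laguerre_eq_gamma_average (hα : -1 / 2 < α)
    (hf : IntegrableOn (fun x => f x * x ^ α) (Ioi 0)) {y : ℝ} (hy : 0 < y) (j : ℕ) :
    j.factorial * ∫ x in Ioi (0 : ℝ), f (x / y) * laguerre α j x * x ^ α * exp (-x) =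
      y ^ (α + 1) * ∫ t in Ioi (0 : ℝ), hankel α f (y * t) * (t ^ j * exp (-t) * t ^ α) := by
  have hα' : -1 < α := by linarith
  have h := integral_mul_hankel_swap hα (integrableOn_comp_mul (inv_pos.2 hy) hf)
    (ψ := fun t => t ^ j * exp (-t)) (integrableOn_pow_mul_exp hα' j)
  rw [← integral_const_mul, ← integral_const_mul]
  refine Eq.trans (setIntegral_congr_fun measurableSet_Ioi fun x _ => ?_)
    (h.trans (setIntegral_congr_fun measurableSet_Ioi fun x _ => ?_))
  · rw [hankel_pow_mul_exp hα', div_eq_inv_mul]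
    ring
  · rw [hankel_comp_mul (inv_pos.2 hy), div_inv_eq_mul, inv_rpow hy.le, ← rpow_neg hy.le,
      mul_comm x y]
    ring_nf

theorem hankel_nonneg (hα : -1 / 2 < α) (hf : IntegrableOn (fun x => f x * x ^ α) (Ioi 0))
    (hN : ∀ y, 0 < y → ∀ j : ℕ,
      0 ≤ ∫ x in Ioi (0 : ℝ), f (x / y) * laguerre α j x * x ^ α * exp (-x))
    {s : ℝ} (hs : 0 < s) : 0 ≤ hankel α f s := by
  obtain ⟨B, hB⟩ := exists_abs_hankel_le hα hf
  refine nonneg_of_gamma_averages_nonneg (α := α) (by linarith)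
    ((continuousOn_hankel hα hf).mono Ioi_subset_Ici_self) (fun x hx => hB x hx.le)
    (fun y hy j => ?_) hs
  have h := mul_nonneg (Nat.cast_nonneg (α := ℝ) j.factorial) (hN y hy j)
  rw [integral_laguerre_eq_gamma_average hα hf hy] at h
  exact nonneg_of_mul_nonneg_right h (rpow_pos_of_pos hy _)

theorem laguerre_zero (hα : -1 < α) (x : ℝ) : laguerre α 0 x = 1 := by
  have := (Gamma_nat_add_pos hα 0).ne'
  simp_all [laguerre]

/-- The average with j = 0, rescaled by s = y t: it equals ∫ f(x/y) x^α e^(-x) dx. The bound is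
independent of y, which is what lets the exponential weight be removed. -/
theorem integral_hankel_mul_exp (hα : -1 / 2 < α) (hfc : ContinuousOn f (Ici 0))
    (hM : ∀ x, 0 ≤ x → |f x| ≤ M) (hf : IntegrableOn (fun x => f x * x ^ α) (Ioi 0))
    {y : ℝ} (hy : 0 < y) :
    IntegrableOn (fun s => hankel α f s * exp (-(s / y)) * s ^ α) (Ioi 0) ∧
      ∫ s in Ioi (0 : ℝ), hankel α f s * exp (-(s / y)) * s ^ α ≤ M * Gamma (α + 1) := by
  have hα' : -1 < α := by linarith
  obtain ⟨B, hB⟩ := exists_abs_hankel_le hα hf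
  have hi := integrableOn_comp_mul_gamma hα'
    ((continuousOn_hankel hα hf).mono Ioi_subset_Ici_self) (fun x hx => hB x hx.le) hy 0
  have heq : ∀ t ∈ Ioi (0 : ℝ), hankel α f (y * t) * exp (-(y * t / y)) * (y * t) ^ α =
      y ^ α * (hankel α f (y * t) * (t ^ 0 * exp (-t) * t ^ α)) := by
    intro t (ht : 0 < t)
    rw [mul_div_cancel_left₀ t hy.ne', mul_rpow hy.le ht.le]
    ring
  constructor
  · have h := (integrableOn_Ioi_comp_mul_left_iff
      (fun s => hankel α f s * exp (-(s / y)) * s ^ α) 0 hy).1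
      (IntegrableOn.congr_fun (hi.const_mul (y ^ α)) (fun t ht => (heq t ht).symm) measurableSet_Ioi)
    rwa [mul_zero] at h
  · have h1 := integral_comp_mul_left_Ioi (fun s => hankel α f s * exp (-(s / y)) * s ^ α) 0 hy
    rw [mul_zero, smul_eq_mul, setIntegral_congr_fun measurableSet_Ioi heq, integral_const_mul] at h1
    have h2 := integral_laguerre_eq_gamma_average hα hf hy 0
    rw [rpow_add hy, rpow_one, mul_comm (y ^ α) y, mul_assoc, h1, ← mul_assoc,
      mul_inv_cancel₀ hy.ne', one_mul] at h2
    rw [← h2, Nat.factorial_zero, Nat.cast_one, one_mul]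
    have h3 := integral_pow_mul_exp hα' 0
    rw [CharP.cast_eq_zero, zero_add] at h3
    rw [← h3, ← integral_const_mul]
    have h4 := integrableOn_comp_mul_gamma hα' (hfc.mono Ioi_subset_Ici_self)
      (fun x hx => hM x hx.le) (inv_pos.2 hy) 0
    have h5 : ∀ x ∈ Ioi (0 : ℝ), f (x / y) * laguerre α 0 x * x ^ α * exp (-x) =
        f (y⁻¹ * x) * (x ^ 0 * exp (-x) * x ^ α) := by
      intro x _
      rw [laguerre_zero hα', div_eq_inv_mul]
      ring
    rw [setIntegral_congr_fun measurableSet_Ioi h5]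
    refine setIntegral_mono_on h4 ((integrableOn_pow_mul_exp hα' 0).const_mul M) measurableSet_Ioi
      fun x (hx : 0 < x) => ?_
    refine mul_le_mul_of_nonneg_right ((le_abs_self _).trans (hM _ ?_)) ?_ <;> positivity

theorem integrableOn_hankel (hα : -1 / 2 < α) (hfc : ContinuousOn f (Ici 0))
    (hM : ∀ x, 0 ≤ x → |f x| ≤ M) (hf : IntegrableOn (fun x => f x * x ^ α) (Ioi 0))
    (hF : ∀ s, 0 < s → 0 ≤ hankel α f s) :
    IntegrableOn (fun s => hankel α f s * s ^ α) (Ioi 0) := by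
  -- On (0, n + 1] the weight e^(-s/(n+1)) is at least 1/e, so dropping it costs a factor e
  -- uniformly in n.
  have hbound : ∀ n : ℕ, ∀ s ∈ Ioc (0 : ℝ) (n + 1), ‖hankel α f s * s ^ α‖ ≤
      exp 1 * (hankel α f s * exp (-(s / (n + 1))) * s ^ α) := by
    intro n s hs
    have h0 := hF s hs.1
    have h1 := rpow_nonneg hs.1.le α
    have hn : (0 : ℝ) < n + 1 := by positivity
    have h2 : 1 ≤ exp 1 * exp (-(s / (n + 1))) := by
      rw [← exp_add]
      refine one_le_exp ?_
      have := (div_le_one hn).2 hs.2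
      linarith
    rw [Real.norm_of_nonneg (mul_nonneg h0 h1)]
    nlinarith [mul_le_mul_of_nonneg_left h2 (mul_nonneg h0 h1)]
  have hint : ∀ n : ℕ, IntegrableOn (fun s => exp 1 *
      (hankel α f s * exp (-(s / (n + 1))) * s ^ α)) (Ioi 0) := fun n =>
    (integral_hankel_mul_exp hα hfc hM hf (by positivity : (0 : ℝ) < n + 1)).1.const_mul _
  have hi : ∀ n : ℕ, IntegrableOn (fun s => hankel α f s * s ^ α) (Ioc 0 ((n : ℝ) + 1)) := by
    intro n
    refine Integrable.mono' ((hint n).mono_set Ioc_subset_Ioi_self) ?_ ?_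
    · exact (((continuousOn_hankel hα hf).mono fun x hx => le_of_lt hx.1).mul
        (continuousOn_id.rpow_const fun x hx => Or.inl hx.1.ne')).aestronglyMeasurable
        measurableSet_Ioc
    · filter_upwards [ae_restrict_mem measurableSet_Ioc] with s hs using hbound n s hs
  refine integrableOn_Ioi_of_intervalIntegral_norm_bounded (exp 1 * (M * Gamma (α + 1))) 0 hi
    (tendsto_atTop_add_const_right _ 1 tendsto_natCast_atTop_atTop) (Eventually.of_forall fun n => ?_)
  have hn : (0 : ℝ) < n + 1 := by positivity
  rw [intervalIntegral.integral_of_le hn.le]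
  calc ∫ s in Ioc (0 : ℝ) (n + 1), ‖hankel α f s * s ^ α‖
      ≤ ∫ s in Ioc (0 : ℝ) (n + 1), exp 1 * (hankel α f s * exp (-(s / (n + 1))) * s ^ α) :=
        setIntegral_mono_on (hi n).norm ((hint n).mono_set Ioc_subset_Ioi_self) measurableSet_Ioc
          (hbound n)
    _ ≤ ∫ s in Ioi (0 : ℝ), exp 1 * (hankel α f s * exp (-(s / (n + 1))) * s ^ α) := by
        refine setIntegral_mono_set (hint n) ?_ Ioc_subset_Ioi_self.eventuallyLE
        filter_upwards [ae_restrict_mem measurableSet_Ioi] with s (hs : 0 < s)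
        have := hF s hs
        simp only [Pi.zero_apply]
        positivity
    _ ≤ exp 1 * (M * Gamma (α + 1)) := by
        rw [integral_const_mul]
        exact mul_le_mul_of_nonneg_left (integral_hankel_mul_exp hα hfc hM hf hn).2 (exp_pos 1).le

/-- Symmetry twice: the averages of HHf are Laguerre integrals of Hf, and moving H back onto L_j
e^(-t) restores t^j e^(-t) against f. No inversion theorem is presupposed. -/
theorem gamma_average_hankel_hankel (hα : -1 / 2 < α)
    (hf : IntegrableOn (fun x => f x * x ^ α) (Ioi 0))
    (hF : IntegrableOn (fun s => hankel α f s * s ^ α) (Ioi 0)) {y : ℝ} (hy : 0 < y) (j : ℕ) :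
    ∫ t in Ioi (0 : ℝ), hankel α (hankel α f) (y * t) * (t ^ j * exp (-t) * t ^ α) =
      ∫ t in Ioi (0 : ℝ), f (y * t) * (t ^ j * exp (-t) * t ^ α) := by
  have hα' : -1 < α := by linarith
  have hy1 := rpow_pos_of_pos hy (α + 1)
  have h1 := integral_laguerre_eq_gamma_average hα hF hy j
  have h2 := integral_mul_hankel_swap hα (integrableOn_comp_mul hy hf)
    (ψ := fun t => laguerre α j t * exp (-t)) (integrableOn_laguerre hα' j)
  have h3 : ∫ x in Ioi (0 : ℝ), f (y * x) * x ^ α *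
      hankel α (fun t => laguerre α j t * exp (-t)) x =
      (∫ t in Ioi (0 : ℝ), f (y * t) * (t ^ j * exp (-t) * t ^ α)) / j.factorial := by
    rw [← integral_div]
    refine setIntegral_congr_fun measurableSet_Ioi fun x (hx : 0 < x) => ?_
    rw [hankel_laguerre_mul_exp hα j hx.le]
    ring
  have h4 : ∫ x in Ioi (0 : ℝ), laguerre α j x * exp (-x) * x ^ α *
      hankel α (fun x => f (y * x)) x = (y ^ (α + 1))⁻¹ *
      ∫ x in Ioi (0 : ℝ), hankel α f (x / y) * laguerre α j x * x ^ α * exp (-x) := by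
    rw [← integral_const_mul]
    refine setIntegral_congr_fun measurableSet_Ioi fun x _ => ?_
    rw [hankel_comp_mul hy, ← rpow_neg hy.le]
    ring_nf
  rw [h3, h4, div_eq_iff (by positivity), mul_assoc, mul_comm _ (j.factorial : ℝ), h1,
    ← mul_assoc, inv_mul_cancel₀ hy1.ne', one_mul] at h2
  exact h2.symm

theorem hankel_hankel (hα : -1 / 2 < α) (hfc : ContinuousOn f (Ici 0))
    (hM : ∀ x, 0 ≤ x → |f x| ≤ M) (hf : IntegrableOn (fun x => f x * x ^ α) (Ioi 0))
    (hF : IntegrableOn (fun s => hankel α f s * s ^ α) (Ioi 0)) {x : ℝ} (hx : 0 ≤ x) :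
    hankel α (hankel α f) x = f x := by
  have hα' : -1 < α := by linarith
  obtain ⟨B, hB⟩ := exists_abs_hankel_le hα hF
  have hFc := continuousOn_hankel hα hF
  -- Gamma averages determine a bounded continuous function: the positivity criterion applies to u -
  -- v, and then with the roles exchanged.
  have key : ∀ u v : ℝ → ℝ, ContinuousOn u (Ici 0) → ContinuousOn v (Ici 0) → ∀ A B : ℝ,
      (∀ x, 0 ≤ x → |u x| ≤ A) → (∀ x, 0 ≤ x → |v x| ≤ B) →
      (∀ y, 0 < y → ∀ j : ℕ, ∫ t in Ioi (0 : ℝ), u (y * t) * (t ^ j * exp (-t) * t ^ α) =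
        ∫ t in Ioi (0 : ℝ), v (y * t) * (t ^ j * exp (-t) * t ^ α)) → ∀ x, 0 < x → v x ≤ u x := by
    intro u v hu hv A B hA hB huv x hx
    have hu' := hu.mono Ioi_subset_Ici_self
    have hv' := hv.mono Ioi_subset_Ici_self
    refine sub_nonneg.1 (nonneg_of_gamma_averages_nonneg hα' (h := fun x => u x - v x) (M := A + B)
      (hu'.sub hv') (fun x hx => (abs_sub _ _).trans (add_le_add (hA x hx.le) (hB x hx.le)))
      (fun y hy j => ?_) hx)
    simp only [sub_mul]
    rw [integral_sub (integrableOn_comp_mul_gamma hα' hu' (fun x hx => hA x hx.le) hy j)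
      (integrableOn_comp_mul_gamma hα' hv' (fun x hx => hB x hx.le) hy j), huv y hy j, sub_self]
  have hav := fun y (hy : 0 < y) j => gamma_average_hankel_hankel hα hf hF hy j
  have heq : EqOn (hankel α (hankel α f)) f (Ioi 0) := fun x hx =>
    le_antisymm (key f _ hfc hFc M B hM hB (fun y hy j => (hav y hy j).symm) x hx)
      (key _ f hFc hfc B M hB hM hav x hx)
  exact heq.of_subset_closure hFc hfc Ioi_subset_Ici_self (by rw [closure_Ioi]) hx

end Forward

/-! ### Absolutely continuous measures as Stieltjes measures. -/

theorem exists_stieltjesMeasure_eq_withDensity {ρ : ℝ → ℝ} (hρ : Integrable ρ) (h0 : ∀ x, 0 ≤ ρ x)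
    (hneg : ∀ x ≤ 0, ρ x = 0) :
    ∃ (g : ℝ → ℝ) (hg : MonotoneOn g (Ici 0)),
      stieltjesMeasure hg = volume.withDensity fun x => ENNReal.ofReal (ρ x) := by
  have hii : ∀ a b, IntervalIntegrable ρ volume a b := fun a b => hρ.intervalIntegrable
  set g : ℝ → ℝ := fun b => ∫ x in (0 : ℝ)..b, ρ x with hg
  have hsub : ∀ a b, g b - g a = ∫ x in a..b, ρ x := fun a b =>
    intervalIntegral.integral_interval_sub_left (hii 0 b) (hii 0 a)
  have hmono : Monotone g := fun a b hab =>
    sub_nonneg.1 ((hsub a b).symm ▸ intervalIntegral.integral_nonneg hab fun x _ => h0 x)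
  -- As ρ vanishes on (-∞, 0], the primitive based at 0 is already its own constant extension to the
  -- left.
  have hmax : (fun y => g (max y 0)) = g := by
    funext y
    rcases le_total y 0 with hy | hy
    · rw [max_eq_right hy, ← sub_eq_zero, hsub, intervalIntegral.integral_congr (g := fun _ => 0)]
      · simp
      · intro x hx
        rw [uIcc_of_le hy] at hx
        exact hneg x hx.2
    · rw [max_eq_left hy]
  have : IsLocallyFiniteMeasure (stieltjesMeasure (hmono.monotoneOn (Ici 0))) := by
    unfold stieltjesMeasure
    infer_instance
  refine ⟨g, hmono.monotoneOn _, Measure.ext_of_Ioc _ _ fun a b hab => ?_⟩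
  have hlim : ∀ x, (monotone_comp_max (hmono.monotoneOn (Ici 0))).stieltjesFunction x = g x := by
    intro x
    rw [Monotone.stieltjesFunction_eq]
    have hc : Continuous g := intervalIntegral.continuous_primitive hii 0
    rw [(monotone_comp_max (hmono.monotoneOn (Ici 0))).continuousWithinAt_Ioi_iff_rightLim_eq.1]
    · exact congrFun hmax x
    · rw [hmax]
      exact hc.continuousWithinAt
  rw [stieltjesMeasure, StieltjesFunction.measure_Ioc, hlim, hlim, hsub,
    intervalIntegral.integral_of_le hab.le, withDensity_apply _ measurableSet_Ioc]
  exact ofReal_integral_eq_lintegral_ofReal hρ.integrableOn (ae_of_all _ h0)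

end SILP

end

/-! ### The equivalence. -/

open SILP MeasureTheory

theorem proposition2p9 (α : ℝ) (hα : -1 / 2 < α) (f : ℝ → ℝ)
    (hf : ContinuousOn f (Set.Ici 0))
    (hdecay : ∃ C : ℝ, 0 < C ∧ ∃ ε : ℝ, 0 < ε ∧
      ∀ x, 0 ≤ x → |f x| ≤ C * (1 + |x|) ^ (-α - 1 - ε)) :
    SILP.HasSILP α f ↔
      ∃ (g : ℝ → ℝ) (hg : MonotoneOn g (Set.Ici 0)), ∀ x, 0 ≤ x →
        MeasureTheory.IntegrableOn (fun y => SILP.besselKernel α (x * y)) (Set.Ici 0)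
          (SILP.stieltjesMeasure hg) ∧
        f x = ∫ y in Set.Ici (0 : ℝ), SILP.besselKernel α (x * y) ∂(SILP.stieltjesMeasure hg) := by
  have hα' : -1 < α := by linarith
  have hGamma : 0 < Real.Gamma (α + 1) := Real.Gamma_pos_of_pos (by linarith)
  obtain ⟨C, hC, ε, hε, hb⟩ := hdecay
  have hint := integrableOn_mul_rpow_of_decay hα' hf hC hε hb
  have hbdd : ∀ x, 0 ≤ x → |f x| ≤ C := fun x hx => abs_le_of_decay hα' hC hε hb hx
  constructor
  · rintro ⟨-, hpos⟩
    have hF : ∀ s, 0 < s → 0 ≤ hankel α f s := fun s hs =>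
      hankel_nonneg hα hint (fun y hy j => (laguerreCoeff_nonneg_iff hα' _ j).1 (hpos y hy j)) hs
    have hFi := integrableOn_hankel hα hf hbdd hint hF
    set ρ : ℝ → ℝ := (Set.Ioi 0).indicator fun s => hankel α f s * s ^ α with hρdef
    have hρ : Integrable ρ := (integrable_indicator_iff measurableSet_Ioi).2 hFi
    have hρ0 : ∀ s, 0 ≤ ρ s := Set.indicator_nonneg fun s hs =>
      mul_nonneg (hF s hs) (Real.rpow_nonneg (le_of_lt hs) α)
    have hρneg : ∀ s ≤ 0, ρ s = 0 := fun s hs => Set.indicator_of_notMem (not_lt.2 hs) _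
    obtain ⟨g, hg, hgρ⟩ := exists_stieltjesMeasure_eq_withDensity hρ hρ0 hρneg
    have hm : AEMeasurable (fun s => ENNReal.ofReal (ρ s)) := hρ.1.aemeasurable.ennreal_ofReal
    have hfin : IsFiniteMeasure (stieltjesMeasure hg) := by
      rw [hgρ]; exact isFiniteMeasure_withDensity_ofReal hρ.2
    have hae : ∀ᵐ s ∂stieltjesMeasure hg, s ∈ Set.Ici (0 : ℝ) := by
      rw [hgρ, ae_withDensity_iff' hm]
      refine ae_of_all _ fun s hs => ?_
      by_contra hneg
      exact hs (by rw [hρneg s (le_of_lt (not_le.1 hneg)), ENNReal.ofReal_zero])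
    refine ⟨g, hg, fun x hx => ?_⟩
    have hk : Set.EqOn (fun y => besselKernel α (x * y)) (fun y => besselSeries α (y * x) * 1)
        (Set.Ici 0) := fun y (hy : 0 ≤ y) => by
      simp only [mul_one]
      rw [besselKernel_eq (mul_nonneg hx hy), mul_comm]
    constructor
    · refine IntegrableOn.congr_fun ?_ hk.symm measurableSet_Ici
      exact (integrable_besselSeries_mul hα hae (integrable_const (1 : ℝ)) hx).integrableOn
    -- With density Hf(s) s^α, the Stieltjes integral is HHf(x), which is f(x) by inversion.
    · rw [setIntegral_congr_fun measurableSet_Ici hk, Measure.restrict_eq_self_of_ae_mem hae, hgρ,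
        integral_withDensity_eq_integral_toReal_smul₀ hm (ae_of_all _ fun _ => ENNReal.ofReal_lt_top),
        ← hankel_hankel hα hf hbdd hint hFi hx, hankel, ← integral_indicator measurableSet_Ioi]
      refine integral_congr_ae (ae_of_all _ fun s => ?_)
      simp only [ENNReal.toReal_ofReal (hρ0 s), smul_eq_mul, mul_one]
      by_cases hs : s ∈ Set.Ioi (0 : ℝ)
      · rw [hρdef, Set.indicator_of_mem hs, Set.indicator_of_mem hs, mul_comm]
      · rw [hρdef, Set.indicator_of_notMem hs, Set.indicator_of_notMem hs, zero_mul]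
  · rintro ⟨g, hg, h⟩
    refine ⟨⟨hf, ε, hε, C, hC, hb⟩, fun y hy j => (laguerreCoeff_nonneg_iff hα' _ j).2 ?_⟩
    have hfin : IsFiniteMeasure ((stieltjesMeasure hg).restrict (Set.Ici 0)) := by
      -- At x = 0 the kernel is the nonzero constant 1 / Γ(α + 1), so its integrability says that dg
      -- is finite.
      have h0 := (h 0 le_rfl).1
      simp only [zero_mul, besselKernel, if_true] at h0
      exact (integrable_const_iff_isFiniteMeasure (one_div_pos.2 hGamma).ne').1 h0
    have hae : ∀ᵐ s ∂((stieltjesMeasure hg).restrict (Set.Ici 0)), 0 ≤ s :=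
      ae_restrict_mem measurableSet_Ici
    refine integral_laguerre_nonneg_of_measure hα hae (fun x hx => ?_) hy j
    rw [(h x hx).2]
    refine setIntegral_congr_fun measurableSet_Ici fun s (hs : 0 ≤ s) => ?_
    rw [besselKernel_eq (mul_nonneg hx hs), mul_comm]
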